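/- Let $n\ge 0$ and let $\mathcal X_0,\dots,\mathcal X_n$ and $\mathcal Y_0,\dots,\mathcal Y_n$ be Polish spaces with their Borel $\sigma$-algebras. Write $\mathcal X_{0,i}=\prod_{j\le i}\mathcal X_j$, $x^i=(x_0,\dots,x_i)$, and similarly for $\mathcal Y$; $y^{-1}$ is the empty sequence. Let $P_{X^n}$ be a Borel probability measure on $\mathcal X_{0,n}$, let $\rho_{0,i}:\mathcal X_{0,i}\times\mathcal Y_{0,i}\to[0,\infty]$ $(0\le i\le n)$ be measurable, and put $d_{0,n}(x^n,y^n)=\sum_{i=0}^n\rho_{0,i}(x^i,y^i)$. For $D\in[0,\infty)$ let $\overrightarrow Q_{0,n}(D)$ be the set of all stochastic kernels $P_{Y^n|X^n}$ from $\mathcal X_{0,n}$ to $\mathcal Y_{0,n}$ such that (i) (realizability) there are stochastic kernels $P_{Y_i|Y^{i-1},X^i}(dy_i|y^{i-1},x^i)$, $0\le i\le n$, with $P_{Y^n|X^n}(dy^n|x^n)=\bigotimes_{i=0}^nP_{Y_i|Y^{i-1},X^i}(dy_i|y^{i-1},x^i)$ for $P_{X^n}$-almost every $x^n$; (ii) (fidelity)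 $\int d_{0,n}(x^n,y^n)\,P_{Y^n|X^n}(dy^n|x^n)\,P_{X^n}(dx^n)\le D$. Let $\mathbb I(P_{X^n},P_{Y^n|X^n})=\mathbb D(P_{X^n,Y^n}\,\|\,P_{X^n}\times P_{Y^n})\in[0,\infty]$ denote the mutual information, where $\mathbb D$ is the Kullback–Leibler divergence, $P_{X^n,Y^n}=P_{Y^n|X^n}\otimes P_{X^n}$ and $P_{Y^n}$ is its second marginal. The causal rate distortion function is $$R^c_{0,n}(D)=\inf_{P_{Y^n|X^n}\in\overrightarrow Q_{0,n}(D)}\mathbb I(P_{X^n},P_{Y^n|X^n}).$$ Suppose that $\mathcal Y_{0,n}$ is compact, that $d_{0,n}(x^n,\cdot)$ is continuous on $\mathcal Y_{0,n}$ for every $x^n\in\mathcal X_{0,n}$, and that $\overrightarrow Q_{0,n}(D)$ is non-empty. Then the infimum is attained: there is $P^*_{Y^n|X^n}\in\overrightarrow Q_{0,n}(D)$ with $\mathbb I(P_{X^n},P^*_{Y^n|X^n})=R^c_{0,n}(D)$. -/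

import Mathlib

open MeasureTheory ProbabilityTheory
open scoped ENNReal NNReal

noncomputable section

namespace CausalRD

/-- The space `Z₀ × ⋯ × Z_{k-1}` of histories of length `k` (a single point if `k = 0`). -/
abbrev Hist (Z : ℕ → Type*) (k : ℕ) : Type _ := ∀ j : Fin k, Z j

/-- The first `k` entries of a history of length `m ≥ k`. -/
def Hist.take {Z : ℕ → Type*} {k m : ℕ} (h : k ≤ m) (z : Hist Z m) : Hist Z k :=
  fun j => z (Fin.castLE h j)

/-- Append the entry `z_k` to the history `(z₀, …, z_{k-1})`. -/
def Hist.append {Z : ℕ → Type*} {k : ℕ} (p : Hist Z k × Z k) : Hist Z (k + 1) :=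
  Fin.snoc (α := fun j : Fin (k + 1) => Z j) p.1 p.2

section measurability

variable {Z : ℕ → Type*} [∀ i, MeasurableSpace (Z i)]

theorem Hist.measurable_take {k m : ℕ} (h : k ≤ m) :
    Measurable (Hist.take (Z := Z) h) :=
  measurable_pi_lambda _ fun j => measurable_pi_apply (Fin.castLE h j)

theorem Hist.measurable_append {k : ℕ} : Measurable (Hist.append (Z := Z) (k := k)) := by
  refine measurable_pi_lambda _ fun j => ?_
  refine Fin.lastCases ?_ (fun i => ?_) j
  · simpa [Hist.append, Fin.snoc_last] using measurable_snd
  · have : (fun p : Hist Z k × Z k => Hist.append p i.castSucc) = fun p => p.1 i := by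
      funext p
      exact Fin.snoc_castSucc (α := fun j : Fin (k + 1) => Z j) p.2 p.1 i
    rw [this]
    exact (measurable_pi_apply i).comp measurable_fst

end measurability

variable {X Y : ℕ → Type*} [∀ i, MeasurableSpace (X i)] [∀ i, MeasurableSpace (Y i)]

/-- The causal product `⊗_{i<k} q_i(dy_i | y^{i-1}, x^i)`, a kernel from `x^{k-1}` to
`y^{k-1}`. -/
def causalProd (q : ∀ i, Kernel (Hist X (i + 1) × Hist Y i) (Y i)) :
    ∀ k, Kernel (Hist X k) (Hist Y k)
  | 0 => Kernel.const _ (Measure.dirac fun j => j.elim0)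
  | k + 1 =>
    (((causalProd q k).comap (Hist.take k.le_succ) (Hist.measurable_take _)) ⊗ₖ q k).map
      Hist.append

/-- The realizability constraint for the source law `μ` of `X^n`: the conditional
distributions `κ(dy^n | x^n)` that agree, for `μ`-almost every `x^n`, with the causal product
of some conditional distributions `q_i(dy_i | y^{i-1}, x^i)`, `0 ≤ i ≤ n`. -/
def realizable {n : ℕ} (μ : Measure (Hist X (n + 1))) :
    Set (Kernel (Hist X (n + 1)) (Hist Y (n + 1))) :=
  {κ | IsMarkovKernel κ ∧
    ∃ q : ∀ i, Kernel (Hist X (i + 1) × Hist Y i) (Y i),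
      (∀ i ≤ n, IsMarkovKernel (q i)) ∧ ∀ᵐ x ∂μ, κ x = causalProd q (n + 1) x}

/-- `d_{0,n}(x^n, y^n) = ∑_{i=0}^n ρ_i(x^i, y^i)`. -/
def distortion {X Y : ℕ → Type*} (ρ : ∀ i, Hist X (i + 1) → Hist Y (i + 1) → ℝ≥0∞) (n : ℕ)
    (x : Hist X (n + 1)) (y : Hist Y (n + 1)) : ℝ≥0∞ :=
  ∑ i : Fin (n + 1), ρ i (x.take i.isLt) (y.take i.isLt)

/-- The realizable kernels whose average distortion is at most `D`. -/
def fidelitySet {n : ℕ} (μ : Measure (Hist X (n + 1)))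
    (ρ : ∀ i, Hist X (i + 1) → Hist Y (i + 1) → ℝ≥0∞) (D : ℝ≥0) :
    Set (Kernel (Hist X (n + 1)) (Hist Y (n + 1))) :=
  {κ | ∫⁻ p, distortion ρ n p.1 p.2 ∂(μ ⊗ₘ κ) ≤ D} ∩ realizable μ

/-- The mutual information `D(P_{XY} ‖ P_X × P_Y)` of an input with law `μ` and the output
of the channel `κ`. -/
def mutualInfo {A B : Type*} [MeasurableSpace A] [MeasurableSpace B] (μ : Measure A)
    (κ : Kernel A B) : ℝ≥0∞ :=
  InformationTheory.klDiv (μ ⊗ₘ κ) (μ.prod (κ ∘ₘ μ))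

/-- The causal rate distortion function. -/
def causalRDF {n : ℕ} (μ : Measure (Hist X (n + 1)))
    (ρ : ∀ i, Hist X (i + 1) → Hist Y (i + 1) → ℝ≥0∞) (D : ℝ≥0) : ℝ≥0∞ :=
  ⨅ κ ∈ fidelitySet μ ρ D, mutualInfo μ κ

end CausalRD

end

/-!
By the Donsker–Varadhan formula, mutual information is a weakly lower semicontinuous function of
the joint law of source and output. Hence it attains its minimum over the joint laws of the kernels
in the fidelity set as soon as these form a weakly compact set.

Joint laws with source law `μ` form a compact set, because the output space is compact. On this set
`∫ F(x, y) dν` is continuous in `ν` whenever `F` is a bounded Carathéodory function: then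
`x ↦ F(x, ·)` belongs to `L¹(μ; C(Y))`, where it is approximated by bounded continuous functions,
uniformly in `ν`. Therefore the expected distortion is lower semicontinuous, being a supremum of
such integrals.

A joint law comes from a causal product if and only if, for every `k`, the conditional law of the
first `k` outputs given the source depends only on the first `k` source symbols. The laws
`μ ⊗ f^* κ` with `κ` depending on `f(x)` only are the images of the compact set of laws with first
marginal `f_* μ` under the continuous map that resamples `x` given `f(x)`, so causality is a closed
condition.
-/

open Filter Topology InformationTheory
open scoped BoundedContinuousFunction

namespace CausalRD

section VariationalFormula

theorem mul_add_one_sub_exp_le_klFun {r : ℝ} (hr : 0 ≤ r) (t : ℝ) :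
    r * t + 1 - Real.exp t ≤ klFun r := by
  rcases hr.eq_or_lt with rfl | hr
  · simpa only [zero_mul, zero_add, klFun_zero, sub_le_self_iff] using Real.exp_nonneg t
  · have h := mul_le_mul_of_nonneg_left (Real.add_one_le_exp (t - Real.log r)) hr.le
    rw [Real.exp_sub, Real.exp_log hr, mul_div_cancel₀ _ hr.ne'] at h
    rw [klFun_apply]
    linarith

/-- The number `r` clamped to `[1 / (m + 1), m + 1]`. The logarithms of clamped densities are
bounded test functions which are asymptotically optimal in the variational formula. -/
noncomputable def clamp (m : ℕ) (r : ℝ) : ℝ := max (1 / ((m : ℝ) + 1)) (min ((m : ℝ) + 1) r)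

theorem measurable_clamp (m : ℕ) : Measurable (clamp m) := by
  unfold clamp
  fun_prop

theorem clamp_pos (m : ℕ) (r : ℝ) : 0 < clamp m r :=
  lt_max_of_lt_left (by positivity)

theorem one_div_add_one_le_one (m : ℕ) : 1 / ((m : ℝ) + 1) ≤ 1 :=
  (div_le_one (by positivity)).2 (le_add_of_nonneg_left m.cast_nonneg)

theorem clamp_le (m : ℕ) (r : ℝ) : clamp m r ≤ m + 1 :=
  max_le ((one_div_add_one_le_one m).trans (le_add_of_nonneg_left m.cast_nonneg)) (min_le_left _ _)

theorem abs_log_clamp_le (m : ℕ) (r : ℝ) : |Real.log (clamp m r)| ≤ Real.log (m + 1) := by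
  rw [abs_le, ← Real.log_inv, ← one_div]
  exact ⟨Real.log_le_log (by positivity) (le_max_left _ _),
    Real.log_le_log (clamp_pos m r) (clamp_le m r)⟩

theorem tendsto_clamp {r : ℝ} (hr : 0 ≤ r) : Tendsto (fun m => clamp m r) atTop (𝓝 r) := by
  have hmin : Tendsto (fun m : ℕ => min ((m : ℝ) + 1) r) atTop (𝓝 r) := by
    refine tendsto_const_nhds.congr' ?_
    filter_upwards [eventually_ge_atTop ⌈r⌉₊] with m hm
    exact (min_eq_right ((Nat.ceil_le.1 hm).trans (by linarith))).symm
  simpa only [max_eq_right hr, clamp] using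
    (tendsto_one_div_add_atTop_nhds_zero_nat (𝕜 := ℝ)).max hmin

theorem mul_log_clamp_add_one_sub_clamp_nonneg (m : ℕ) (r : ℝ) :
    0 ≤ r * Real.log (clamp m r) + 1 - clamp m r := by
  have hkl := klFun_nonneg (clamp_pos m r).le
  rw [klFun_apply] at hkl
  rcases le_total 1 r with hr | hr
  · have hone : 1 ≤ clamp m r :=
      le_max_of_le_right (le_min (le_add_of_nonneg_left m.cast_nonneg) hr)
    have hle : clamp m r ≤ r := max_le ((one_div_add_one_le_one m).trans hr) (min_le_right _ _)
    linarith [mul_le_mul_of_nonneg_right hle (Real.log_nonneg hone)]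
  · have hone : clamp m r ≤ 1 :=
      max_le (one_div_add_one_le_one m) ((min_le_right _ _).trans hr)
    have hle : r ≤ clamp m r :=
      le_max_of_le_right (le_min (hr.trans (le_add_of_nonneg_left m.cast_nonneg)) le_rfl)
    linarith [mul_le_mul_of_nonpos_right hle (Real.log_nonpos (clamp_pos m r).le hone)]

theorem tendsto_mul_log_clamp_add_one_sub_clamp {r : ℝ} (hr : 0 ≤ r) :
    Tendsto (fun m => r * Real.log (clamp m r) + 1 - clamp m r) atTop (𝓝 (klFun r)) := by
  have hclamp := tendsto_clamp hr
  rcases hr.eq_or_lt with rfl | hpos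
  · simpa only [zero_mul, zero_add, klFun_zero, sub_zero] using hclamp.const_sub 1
  · rw [klFun_apply]
    exact (((hclamp.log hpos.ne').const_mul r).add_const 1).sub hclamp

variable {Ω : Type*} [MeasurableSpace Ω] {ν π : Measure Ω}

/-- The functional `f ↦ ∫ f dν + ∫ (1 - e^f) dπ`, whose supremum over test functions `f` is the
Kullback–Leibler divergence of `ν` from `π`: the function `t ↦ e^t - 1` is the Legendre transform
of `klFun`. -/
noncomputable def klDual (ν π : Measure Ω) (f : Ω → ℝ) : ℝ :=
  ∫ ω, f ω ∂ν + ∫ ω, (1 - Real.exp (f ω)) ∂π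

theorem integrable_of_abs_le [IsFiniteMeasure π] {f : Ω → ℝ} (hf : Measurable f) {B : ℝ}
    (hB : ∀ ω, |f ω| ≤ B) : Integrable f π :=
  .of_bound hf.aestronglyMeasurable B (ae_of_all _ hB)

theorem abs_one_sub_exp_le {t B : ℝ} (ht : |t| ≤ B) : |1 - Real.exp t| ≤ 1 + Real.exp B := by
  have hexp : Real.exp t ≤ Real.exp B := Real.exp_le_exp.2 ((le_abs_self t).trans ht)
  rw [abs_le]
  constructor <;> linarith [Real.exp_pos t, Real.exp_pos B]

theorem integrable_one_sub_exp [IsFiniteMeasure π] {f : Ω → ℝ} (hf : Measurable f) {B : ℝ}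
    (hB : ∀ ω, |f ω| ≤ B) : Integrable (fun ω => 1 - Real.exp (f ω)) π :=
  integrable_of_abs_le (hf.exp.const_sub 1) fun ω => abs_one_sub_exp_le (hB ω)

theorem integrable_rnDeriv_mul [IsFiniteMeasure ν] [SigmaFinite π] (hac : ν ≪ π) {f : Ω → ℝ}
    (hf : Measurable f) {B : ℝ} (hB : ∀ ω, |f ω| ≤ B) :
    Integrable (fun ω => (ν.rnDeriv π ω).toReal * f ω) π :=
  (integrable_rnDeriv_smul_iff hac).2 (integrable_of_abs_le hf hB)

theorem klDual_eq_integral_rnDeriv [IsFiniteMeasure ν] [IsFiniteMeasure π] (hac : ν ≪ π)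
    {f : Ω → ℝ} (hf : Measurable f) {B : ℝ} (hB : ∀ ω, |f ω| ≤ B) :
    klDual ν π f = ∫ ω, ((ν.rnDeriv π ω).toReal * f ω + (1 - Real.exp (f ω))) ∂π := by
  rw [integral_add (integrable_rnDeriv_mul hac hf hB) (integrable_one_sub_exp hf hB), klDual]
  exact congrArg (· + _) (integral_rnDeriv_smul hac).symm

theorem ofReal_klDual_le_klDiv [IsFiniteMeasure ν] [IsFiniteMeasure π] {f : Ω → ℝ}
    (hf : Measurable f) {B : ℝ} (hB : ∀ ω, |f ω| ≤ B) :
    ENNReal.ofReal (klDual ν π f) ≤ klDiv ν π := by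
  by_cases htop : klDiv ν π = ∞
  · exact htop ▸ le_top
  obtain ⟨hac, hllr⟩ := klDiv_ne_top_iff.1 htop
  have hkl : Integrable (fun ω => klFun (ν.rnDeriv π ω).toReal) π :=
    (integrable_klFun_rnDeriv_iff hac).2 hllr
  rw [klDiv_eq_lintegral_klFun_of_ac hac, ← ofReal_integral_eq_lintegral_ofReal hkl
    (ae_of_all _ fun _ => klFun_nonneg ENNReal.toReal_nonneg), klDual_eq_integral_rnDeriv hac hf hB]
  refine ENNReal.ofReal_le_ofReal (integral_mono
    ((integrable_rnDeriv_mul hac hf hB).add (integrable_one_sub_exp hf hB)) hkl fun ω => ?_)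
  rw [← add_sub_assoc]
  exact mul_add_one_sub_exp_le_klFun ENNReal.toReal_nonneg _

theorem absolutelyContinuous_of_forall_klDual_le [IsFiniteMeasure ν] {C : ℝ}
    (hC : ∀ f : Ω → ℝ, Measurable f → ∀ B, (∀ ω, |f ω| ≤ B) → klDual ν π f ≤ C) : ν ≪ π := by
  refine Measure.AbsolutelyContinuous.mk fun s hs hπ => ?_
  by_contra hne
  have hpos : 0 < ν.real s := measureReal_nonneg.lt_of_ne' ((measureReal_ne_zero_iff).2 hne)
  let t : ℝ := (|C| + 1) / ν.real s
  have hdual : klDual ν π (s.indicator fun _ => t) = |C| + 1 := by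
    have hexp : (fun ω => 1 - Real.exp (s.indicator (fun _ => t) ω)) =ᵐ[π] 0 := by
      filter_upwards [measure_eq_zero_iff_ae_notMem.1 hπ] with ω hω
      simp only [Set.indicator_of_notMem hω, Real.exp_zero, sub_self, Pi.zero_apply]
    rw [klDual, integral_congr_ae hexp, integral_indicator_const _ hs, smul_eq_mul,
      mul_div_cancel₀ _ hpos.ne']
    simp only [Pi.zero_apply, integral_zero, add_zero]
  have hbound : ∀ ω, |s.indicator (fun _ => t) ω| ≤ |t| := fun ω =>
    norm_indicator_le_norm_self (fun _ => t) ω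
  linarith [hC _ (measurable_const.indicator hs) _ hbound, le_abs_self C]

theorem klDiv_le_of_forall_measurable [IsFiniteMeasure ν] [IsFiniteMeasure π] {C : ℝ}
    (hC : ∀ f : Ω → ℝ, Measurable f → ∀ B, (∀ ω, |f ω| ≤ B) → klDual ν π f ≤ C) :
    klDiv ν π ≤ ENNReal.ofReal C := by
  have hac := absolutelyContinuous_of_forall_klDual_le hC
  let r : Ω → ℝ := fun ω => (ν.rnDeriv π ω).toReal
  have hclamp (m : ℕ) : Measurable fun ω => clamp m (r ω) :=
    (measurable_clamp m).comp (Measure.measurable_rnDeriv ν π).ennreal_toReal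
  let F : ℕ → Ω → ℝ := fun m ω => r ω * Real.log (clamp m (r ω)) + 1 - clamp m (r ω)
  have hF (m : ℕ) : Measurable (F m) :=
    (((Measure.measurable_rnDeriv ν π).ennreal_toReal.mul (hclamp m).log).add_const 1).sub
      (hclamp m)
  have hbound (m : ℕ) : ∫⁻ ω, ENNReal.ofReal (F m ω) ∂π ≤ ENNReal.ofReal C := by
    have hlog (ω : Ω) := abs_log_clamp_le m (r ω)
    have hFexp : F m = fun ω =>
        r ω * Real.log (clamp m (r ω)) + (1 - Real.exp (Real.log (clamp m (r ω)))) := by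
      simp only [F, Real.exp_log (clamp_pos m _), add_sub_assoc]
    have hint : Integrable (F m) π := hFexp ▸
      (integrable_rnDeriv_mul hac (hclamp m).log hlog).add
        (integrable_one_sub_exp (hclamp m).log hlog)
    have hdual : ∫ ω, F m ω ∂π = klDual ν π fun ω => Real.log (clamp m (r ω)) := by
      rw [klDual_eq_integral_rnDeriv hac (hclamp m).log hlog, hFexp]
    rw [← ofReal_integral_eq_lintegral_ofReal hint
      (ae_of_all _ fun ω => mul_log_clamp_add_one_sub_clamp_nonneg m (r ω)), hdual]
    exact ENNReal.ofReal_le_ofReal (hC _ (hclamp m).log _ hlog)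
  rw [klDiv_eq_lintegral_klFun_of_ac hac]
  calc ∫⁻ ω, ENNReal.ofReal (klFun (r ω)) ∂π
      = ∫⁻ ω, liminf (fun m => ENNReal.ofReal (F m ω)) atTop ∂π :=
        lintegral_congr fun ω => ((ENNReal.continuous_ofReal.tendsto _).comp
          (tendsto_mul_log_clamp_add_one_sub_clamp ENNReal.toReal_nonneg)).liminf_eq.symm
    _ ≤ liminf (fun m => ∫⁻ ω, ENNReal.ofReal (F m ω) ∂π) atTop :=
        lintegral_liminf_le fun m => (hF m).ennreal_ofReal
    _ ≤ liminf (fun _ => ENNReal.ofReal C) atTop := liminf_le_liminf (.of_forall hbound)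
    _ = ENNReal.ofReal C := liminf_const _

theorem tendsto_klDual [IsFiniteMeasure ν] [IsFiniteMeasure π] {g : ℕ → Ω → ℝ} {f : Ω → ℝ} {B : ℝ}
    (hg : ∀ n, Measurable (g n)) (hB : ∀ n ω, |g n ω| ≤ B)
    (hν : ∀ᵐ ω ∂ν, Tendsto (fun n => g n ω) atTop (𝓝 (f ω)))
    (hπ : ∀ᵐ ω ∂π, Tendsto (fun n => g n ω) atTop (𝓝 (f ω))) :
    Tendsto (fun n => klDual ν π (g n)) atTop (𝓝 (klDual ν π f)) := by
  refine (tendsto_integral_of_dominated_convergence (fun _ => B)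
    (fun n => (hg n).aestronglyMeasurable) (integrable_const B) (fun n => ae_of_all _ (hB n))
    hν).add (tendsto_integral_of_dominated_convergence (fun _ => 1 + Real.exp B)
    (fun n => ((hg n).exp.const_sub 1).aestronglyMeasurable) (integrable_const _)
    (fun n => ae_of_all _ fun ω => abs_one_sub_exp_le (hB n ω)) ?_)
  filter_upwards [hπ] with ω hω
  exact ((Real.continuous_exp.tendsto _).comp hω).const_sub 1

variable [TopologicalSpace Ω] [BorelSpace Ω]

theorem exists_seq_boundedContinuous_tendsto_ae [TopologicalSpace.PseudoMetrizableSpace Ω]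
    (μ : Measure Ω) [IsFiniteMeasure μ] {f : Ω → ℝ} (hf : Measurable f) {B : ℝ}
    (hB : ∀ ω, |f ω| ≤ B) :
    ∃ g : ℕ → Ω →ᵇ ℝ, (∀ n ω, |g n ω| ≤ B) ∧
      ∀ᵐ ω ∂μ, Tendsto (fun n => g n ω) atTop (𝓝 (f ω)) := by
  rcases isEmpty_or_nonempty Ω with hΩ | ⟨⟨ω₀⟩⟩
  · exact ⟨0, fun _ => isEmptyElim, ae_of_all _ isEmptyElim⟩
  have hB₀ : 0 ≤ B := (abs_nonneg _).trans (hB ω₀)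
  let := TopologicalSpace.pseudoMetrizableSpacePseudoMetric Ω
  have hfp : MemLp f 1 μ := memLp_one_iff_integrable.2 (integrable_of_abs_le hf hB)
  choose g hg _ using fun n : ℕ => hfp.exists_boundedContinuous_eLpNorm_sub_le ENNReal.one_ne_top
    (ε := (n : ℝ≥0∞)⁻¹) (ENNReal.inv_ne_zero.2 (ENNReal.natCast_ne_top n))
  have hmeas : TendstoInMeasure μ (fun n => g n) atTop f := by
    refine tendstoInMeasure_of_tendsto_eLpNorm one_ne_zero
      (fun n => (g n).continuous.aestronglyMeasurable) hf.aestronglyMeasurable ?_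
    refine tendsto_of_tendsto_of_tendsto_of_le_of_le tendsto_const_nhds
      ENNReal.tendsto_inv_nat_nhds_zero (fun _ => zero_le) fun n => ?_
    rw [eLpNorm_sub_comm]
    exact hg n
  obtain ⟨ns, -, hns⟩ := hmeas.exists_seq_tendsto_ae
  refine ⟨fun n => .const Ω (-B) ⊔ (.const Ω B ⊓ g (ns n)), fun n ω => ?_, ?_⟩
  · exact abs_le.2 ⟨le_sup_left, sup_le (neg_le_self hB₀) inf_le_left⟩
  · filter_upwards [hns] with ω hω
    have hlim := (tendsto_const_nhds (x := -B)).max ((tendsto_const_nhds (x := B)).min hω)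
    rwa [min_eq_right (abs_le.1 (hB ω)).2, max_eq_right (abs_le.1 (hB ω)).1] at hlim

theorem klDual_le_of_forall_boundedContinuous [TopologicalSpace.PseudoMetrizableSpace Ω]
    [IsFiniteMeasure ν] [IsFiniteMeasure π] {C : ℝ} (hC : ∀ g : Ω →ᵇ ℝ, klDual ν π g ≤ C)
    {f : Ω → ℝ} (hf : Measurable f) {B : ℝ} (hB : ∀ ω, |f ω| ≤ B) : klDual ν π f ≤ C := by
  obtain ⟨g, hgB, hg⟩ := exists_seq_boundedContinuous_tendsto_ae (ν + π) hf hB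
  obtain ⟨hν, hπ⟩ := ae_add_measure_iff.1 hg
  exact le_of_tendsto' (tendsto_klDual (fun n => (g n).continuous.measurable) hgB hν hπ)
    fun n => hC (g n)

/-- The **Donsker–Varadhan** formula, in its form for finite measures. -/
theorem klDiv_eq_iSup_boundedContinuous [TopologicalSpace.PseudoMetrizableSpace Ω]
    (ν π : Measure Ω) [IsFiniteMeasure ν] [IsFiniteMeasure π] :
    klDiv ν π = ⨆ f : Ω →ᵇ ℝ, ENNReal.ofReal (klDual ν π f) := by
  refine le_antisymm ?_ (iSup_le fun f =>
    ofReal_klDual_le_klDiv f.continuous.measurable f.norm_coe_le_norm)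
  by_cases htop : ⨆ f : Ω →ᵇ ℝ, ENNReal.ofReal (klDual ν π f) = ∞
  · exact htop ▸ le_top
  rw [← ENNReal.ofReal_toReal htop]
  refine klDiv_le_of_forall_measurable fun f hf B hB =>
    klDual_le_of_forall_boundedContinuous (fun g => ?_) hf hB
  exact (ENNReal.ofReal_le_iff_le_toReal htop).1
    (le_iSup (fun g : Ω →ᵇ ℝ => ENNReal.ofReal (klDual ν π g)) g)

theorem continuous_klDual (f : Ω →ᵇ ℝ) :
    Continuous fun p : FiniteMeasure Ω × FiniteMeasure Ω => klDual (p.1 : Measure Ω) p.2 f := by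
  let g : Ω →ᵇ ℝ := .ofNormedAddCommGroup (fun ω => 1 - Real.exp (f ω)) (by fun_prop)
    (1 + Real.exp ‖f‖) fun ω => abs_one_sub_exp_le (f.norm_coe_le_norm ω)
  exact ((FiniteMeasure.continuous_integral_boundedContinuousFunction f).comp continuous_fst).add
    ((FiniteMeasure.continuous_integral_boundedContinuousFunction g).comp continuous_snd)

theorem lowerSemicontinuous_klDiv [TopologicalSpace.PseudoMetrizableSpace Ω] :
    LowerSemicontinuous fun p : FiniteMeasure Ω × FiniteMeasure Ω =>
      klDiv (p.1 : Measure Ω) p.2 := by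
  simp_rw [klDiv_eq_iSup_boundedContinuous]
  exact lowerSemicontinuous_iSup fun f =>
    (ENNReal.continuous_ofReal.comp (continuous_klDual f)).lowerSemicontinuous

end VariationalFormula

theorem lowerSemicontinuous_klDiv_prod_snd {A B : Type*}
    [TopologicalSpace A] [TopologicalSpace.PseudoMetrizableSpace A] [SecondCountableTopology A]
    [MeasurableSpace A] [BorelSpace A]
    [TopologicalSpace B] [TopologicalSpace.PseudoMetrizableSpace B] [SecondCountableTopology B]
    [MeasurableSpace B] [BorelSpace B] (μ : ProbabilityMeasure A) :
    LowerSemicontinuous fun ν : ProbabilityMeasure (A × B) =>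
      klDiv (ν : Measure (A × B)) ((μ : Measure A).prod (ν : Measure (A × B)).snd) := by
  have hsnd : Continuous fun ν : ProbabilityMeasure (A × B) =>
      μ.prod (ν.map continuous_snd.measurable.aemeasurable) :=
    ProbabilityMeasure.continuous_prod.comp
      (continuous_const.prodMk (ProbabilityMeasure.continuous_map continuous_snd))
  exact lowerSemicontinuous_klDiv.comp (ProbabilityMeasure.toFiniteMeasure_continuous.prodMk
    (ProbabilityMeasure.toFiniteMeasure_continuous.comp hsnd))

section FixedFirstMarginal

theorem lintegral_eq_iSup_integral_min {Ω : Type*} [MeasurableSpace Ω] (ν : Measure Ω)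
    [IsFiniteMeasure ν] {f : Ω → ℝ≥0∞} (hf : Measurable f) :
    ∫⁻ ω, f ω ∂ν = ⨆ N : ℕ, ENNReal.ofReal (∫ ω, (min (f ω) N).toReal ∂ν) := by
  have hsup (ω : Ω) : f ω = ⨆ N : ℕ, min (f ω) N := by
    rw [← inf_iSup_eq, ENNReal.iSup_natCast, inf_top_eq]
  have hmeas (N : ℕ) : Measurable fun ω => min (f ω) N := hf.min measurable_const
  rw [lintegral_congr hsup, lintegral_iSup hmeas fun N M h ω => min_le_min_left _ (Nat.cast_le.2 h)]
  refine iSup_congr fun N => ?_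
  have hlt : ∫⁻ ω, min (f ω) N ∂ν < ∞ :=
    (lintegral_mono fun ω => min_le_right (f ω) N).trans_lt
      (IsFiniteMeasure.lintegral_lt_top_of_bounded_to_ennreal ν ⟨N, fun _ => le_rfl⟩)
  rw [integral_toReal (hmeas N).aemeasurable (ae_lt_top (hmeas N) hlt.ne),
    ENNReal.ofReal_toReal hlt.ne]

variable {A B : Type*} [MeasurableSpace A]
  [TopologicalSpace B] [CompactSpace B]

theorem norm_integral_apply_le_integral_norm_fst [MeasurableSpace B] {ν : Measure (A × B)}
    {F : A → C(B, ℝ)} (hF : Integrable F ν.fst) : ‖∫ p, F p.1 p.2 ∂ν‖ ≤ ∫ a, ‖F a‖ ∂ν.fst :=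
  calc ‖∫ p, F p.1 p.2 ∂ν‖ ≤ ∫ p, ‖F p.1‖ ∂ν :=
        norm_integral_le_of_norm_le (hF.norm.comp_measurable measurable_fst)
          (ae_of_all _ fun p => (F p.1).norm_coe_le_norm p.2)
    _ = ∫ a, ‖F a‖ ∂ν.fst :=
        (integral_map measurable_fst.aemeasurable hF.norm.aestronglyMeasurable).symm

variable [TopologicalSpace.MetrizableSpace B]

theorem stronglyMeasurable_continuousMap_of_eval {F : A → C(B, ℝ)}
    (hF : ∀ b, Measurable fun a => F a b) : StronglyMeasurable F := by
  let := borel C(B, ℝ)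
  have : BorelSpace C(B, ℝ) := ⟨rfl⟩
  obtain ⟨s, hs, hdense⟩ := TopologicalSpace.exists_countable_dense B
  have := hs.to_subtype
  let restrict : C(B, ℝ) → s → ℝ := fun g b => g b
  have hrestrict : Continuous restrict := continuous_pi fun b => continuous_eval_const (b : B)
  have hinj : Function.Injective restrict := fun g h hgh => DFunLike.coe_injective
    (g.continuous.ext_on hdense h.continuous fun b hb => congrFun hgh ⟨b, hb⟩)
  -- By the Lusin–Souslin theorem, `restrict` is a measurable embedding.
  exact ((hrestrict.measurable.measurableEmbedding hinj).measurable_comp_iff.1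
    (measurable_pi_lambda _ fun b => hF b)).stronglyMeasurable

theorem integrable_continuousMap_of_eval (μ : Measure A) [IsFiniteMeasure μ] {F : A → C(B, ℝ)}
    (hF : ∀ b, Measurable fun a => F a b) {M : ℝ} (hM : ∀ a b, |F a b| ≤ M) : Integrable F μ :=
  .of_bound (stronglyMeasurable_continuousMap_of_eval hF).aestronglyMeasurable |M|
    (ae_of_all _ fun a => (ContinuousMap.norm_le _ (abs_nonneg M)).2 fun b =>
      (hM a b).trans (le_abs_self M))

theorem integrable_apply_of_integrable_fst [MeasurableSpace B] [BorelSpace B] {ν : Measure (A × B)}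
    {F : A → C(B, ℝ)} (hF : Integrable F ν.fst) : Integrable (fun p => F p.1 p.2) ν := by
  have hFfst : Integrable (fun p => F p.1) ν := hF.comp_measurable measurable_fst
  exact hFfst.norm.mono' (continuous_eval.comp_aestronglyMeasurable
    (hFfst.aestronglyMeasurable.prodMk measurable_snd.aestronglyMeasurable))
    (ae_of_all _ fun p => (F p.1).norm_coe_le_norm p.2)

variable [TopologicalSpace A] [BorelSpace A] [MeasurableSpace B] [BorelSpace B]

theorem continuousOn_integral_apply_of_fst_eq [TopologicalSpace.PseudoMetrizableSpace A]
    {μ : Measure A} [IsFiniteMeasure μ] {F : A → C(B, ℝ)} (hF : Integrable F μ) :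
    ContinuousOn (fun ν : ProbabilityMeasure (A × B) => ∫ p, F p.1 p.2 ∂(ν : Measure (A × B)))
      {ν | (ν : Measure (A × B)).fst = μ} := by
  -- Bounded continuous `G` approximate `F` in `L¹(μ; C(B, ℝ))`, hence uniformly in `ν`.
  refine continuousOn_of_uniform_approx_of_continuousOn fun u hu => ?_
  obtain ⟨ε, hε, hεu⟩ := Metric.mem_uniformity_dist.1 hu
  let := TopologicalSpace.pseudoMetrizableSpacePseudoMetric A
  obtain ⟨G, hFG, hG⟩ := hF.exists_boundedContinuous_integral_sub_le (half_pos hε)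
  let G' : A × B →ᵇ ℝ := .ofNormedAddCommGroup (fun p => G p.1 p.2) (by fun_prop) ‖G‖
    fun p => ((G p.1).norm_coe_le_norm p.2).trans (G.norm_coe_le_norm p.1)
  refine ⟨fun ν => ∫ p, G' p ∂(ν : Measure (A × B)),
    (ProbabilityMeasure.continuous_integral_boundedContinuousFunction G').continuousOn,
    fun ν hν => hεu ?_⟩
  obtain rfl : (ν : Measure (A × B)).fst = μ := hν
  calc dist (∫ p, F p.1 p.2 ∂(ν : Measure (A × B))) (∫ p, G' p ∂(ν : Measure (A × B)))
      = ‖∫ p, (F p.1 - G p.1) p.2 ∂(ν : Measure (A × B))‖ := by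
        rw [dist_eq_norm]
        exact congrArg norm (integral_sub (integrable_apply_of_integrable_fst hF)
          (integrable_apply_of_integrable_fst hG)).symm
    _ ≤ ∫ a, ‖F a - G a‖ ∂(ν : Measure (A × B)).fst :=
        norm_integral_apply_le_integral_norm_fst (hF.sub hG)
    _ ≤ ε / 2 := hFG
    _ < ε := half_lt_self hε

theorem lowerSemicontinuousOn_lintegral_of_fst_eq [TopologicalSpace.PseudoMetrizableSpace A]
    (μ : Measure A) [IsFiniteMeasure μ] {f : A → B → ℝ≥0∞} (hf : Measurable (Function.uncurry f))
    (hc : ∀ a, Continuous (f a)) :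
    LowerSemicontinuousOn
      (fun ν : ProbabilityMeasure (A × B) => ∫⁻ p, f p.1 p.2 ∂(ν : Measure (A × B)))
      {ν | (ν : Measure (A × B)).fst = μ} := by
  let F (N : ℕ) (a : A) : C(B, ℝ) :=
    ⟨fun b => (min (f a b) N).toReal, ENNReal.continuousOn_toReal.comp_continuous
      ((hc a).min continuous_const) fun _ => ne_top_of_le_ne_top (ENNReal.natCast_ne_top N)
        (min_le_right _ _)⟩
  have hF (N : ℕ) : Integrable (F N) μ := by
    refine integrable_continuousMap_of_eval μ (fun b => ?_) (M := N) fun a b => ?_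
    · exact ((hf.comp measurable_prodMk_right).min measurable_const).ennreal_toReal
    · exact (abs_of_nonneg ENNReal.toReal_nonneg).trans_le
        (ENNReal.toReal_mono (ENNReal.natCast_ne_top N) (min_le_right _ _))
  have htrunc (ν : ProbabilityMeasure (A × B)) : ∫⁻ p, f p.1 p.2 ∂(ν : Measure (A × B)) =
      ⨆ N : ℕ, ENNReal.ofReal (∫ p, F N p.1 p.2 ∂(ν : Measure (A × B))) :=
    lintegral_eq_iSup_integral_min _ hf
  simp_rw [htrunc]
  exact lowerSemicontinuousOn_iSup fun N => (ENNReal.continuous_ofReal.comp_continuousOn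
    (continuousOn_integral_apply_of_fst_eq (hF N))).lowerSemicontinuousOn

theorem isClosed_setOf_fst_eq [TopologicalSpace.PseudoMetrizableSpace A] (μ : Measure A)
    [IsProbabilityMeasure μ] :
    IsClosed {ν : ProbabilityMeasure (A × B) | (ν : Measure (A × B)).fst = μ} := by
  let μ' : ProbabilityMeasure A := ⟨μ, inferInstance⟩
  have hpre : {ν : ProbabilityMeasure (A × B) | (ν : Measure (A × B)).fst = μ} =
      (fun ν : ProbabilityMeasure (A × B) =>
        ν.map continuous_fst.measurable.aemeasurable) ⁻¹' {μ'} :=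
    Set.ext fun ν => ProbabilityMeasure.toMeasure_injective.eq_iff
      (a := ν.map continuous_fst.measurable.aemeasurable) (b := μ')
  rw [hpre]
  exact isClosed_singleton.preimage (ProbabilityMeasure.continuous_map continuous_fst)

theorem isCompact_setOf_fst_eq [PolishSpace A] (μ : Measure A) [IsProbabilityMeasure μ] :
    IsCompact {ν : ProbabilityMeasure (A × B) | (ν : Measure (A × B)).fst = μ} := by
  rw [← (isClosed_setOf_fst_eq μ).closure_eq]
  refine isCompact_closure_of_isTightMeasureSet (IsTightMeasureSet.prodMk ?_ .of_compactSpace)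
  refine (isTightMeasureSet_singleton (μ := μ)).subset ?_
  rintro _ ⟨_, ⟨ν, hν, rfl⟩, rfl⟩
  exact hν

end FixedFirstMarginal

section Pullback

variable {A A' B : Type*} [MeasurableSpace A] [MeasurableSpace A'] [MeasurableSpace B]

theorem parallelComp_condDistrib_comp_compProd [StandardBorelSpace A] [Nonempty A]
    (μ : Measure A) [IsFiniteMeasure μ] {f : A → A'} (hf : Measurable f) (κ : Kernel A' B)
    [IsSFiniteKernel κ] :
    (condDistrib id f μ ∥ₖ Kernel.id) ∘ₘ (μ.map f ⊗ₘ κ) = μ ⊗ₘ κ.comap f hf := by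
  let R := condDistrib id f μ
  have hR : (R ×ₖ Kernel.id) ∘ₘ μ.map f = μ.map fun a => (a, f a) := by
    have hcomp : (Kernel.id ×ₖ R) ∘ₘ μ.map f = μ.map fun a => (f a, a) := by
      rw [← Measure.compProd_eq_comp_prod]
      exact compProd_map_condDistrib (Y := id) (X := f) measurable_id.aemeasurable
    rw [← Kernel.swap_prod, ← Measure.comp_assoc, hcomp, Kernel.swap,
      Measure.deterministic_comp_eq_map]
    exact Measure.map_map measurable_swap (hf.prodMk measurable_id)
  calc (R ∥ₖ Kernel.id) ∘ₘ (μ.map f ⊗ₘ κ)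
      = (R ×ₖ κ) ∘ₘ μ.map f := by
        rw [Measure.compProd_eq_comp_prod, Measure.comp_assoc, Kernel.parallelComp_comp_prod,
          Kernel.comp_id, Kernel.id_comp]
    _ = (Kernel.id ∥ₖ κ) ∘ₘ (μ.map fun a => (a, f a)) := by
        rw [← hR, Measure.comp_assoc, Kernel.parallelComp_comp_prod, Kernel.id_comp, Kernel.comp_id]
    _ = μ ⊗ₘ κ.comap f hf := by
        change (Kernel.id ∥ₖ κ) ∘ₘ (μ.map fun a => (id a, f a)) = _
        rw [← Measure.deterministic_comp_eq_map (measurable_id.prodMk hf),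
          ← Kernel.deterministic_prod_deterministic measurable_id hf, Measure.comp_assoc,
          Kernel.parallelComp_comp_prod, Kernel.id_comp, Kernel.comp_deterministic_eq_comap,
          Measure.compProd_eq_comp_prod]
        rfl

variable [TopologicalSpace B] [CompactSpace B] [TopologicalSpace.MetrizableSpace B] [BorelSpace B]
  [TopologicalSpace A] [BorelSpace A]

/-- The law on `A × B` obtained from a law on `A' × B` by passing the first coordinate through the
kernel `R`. -/
noncomputable def transportFst (R : Kernel A' A) [IsMarkovKernel R]
    (ν : ProbabilityMeasure (A' × B)) : ProbabilityMeasure (A × B) :=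
  ⟨(R ∥ₖ Kernel.id) ∘ₘ (ν : Measure (A' × B)), inferInstance⟩

theorem integral_transportFst (R : Kernel A' A) [IsMarkovKernel R]
    (ν : ProbabilityMeasure (A' × B)) (g : A × B →ᵇ ℝ) :
    ∫ p, g p ∂(transportFst R ν : Measure (A × B)) =
      ∫ p, ∫ a, g (a, p.2) ∂(R p.1) ∂(ν : Measure (A' × B)) := by
  have hg (p : A' × B) : Integrable g ((R p.1).prod (.dirac p.2)) := g.integrable _
  rw [transportFst, ProbabilityMeasure.coe_mk, Measure.comp_eq_comp_const_apply,
    Kernel.integral_comp (g.integrable _), Kernel.const_apply]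
  simp only [Kernel.parallelComp_apply, Kernel.id_apply, integral_prod g (hg _), integral_dirac]

theorem continuousOn_transportFst [TopologicalSpace A'] [TopologicalSpace.PseudoMetrizableSpace A']
    [BorelSpace A'] (μ : Measure A') [IsFiniteMeasure μ]
    (R : Kernel A' A) [IsMarkovKernel R] :
    ContinuousOn (transportFst (B := B) R) {ν | (ν : Measure (A' × B)).fst = μ} := by
  intro ν₀ hν₀
  refine ProbabilityMeasure.tendsto_iff_forall_integral_tendsto.2 fun g => ?_
  have hsection (b : B) : Continuous fun x => g (x, b) := by fun_prop
  let F (a : A') : C(B, ℝ) := ⟨fun b => ∫ x, g (x, b) ∂(R a),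
    continuous_of_dominated (bound := fun _ => ‖g‖)
      (fun b => (hsection b).aestronglyMeasurable)
      (fun b => ae_of_all _ fun x => g.norm_coe_le_norm (x, b)) (integrable_const _)
      (ae_of_all _ fun x => by fun_prop)⟩
  have hF : Integrable F μ := by
    refine integrable_continuousMap_of_eval μ (fun b => ?_) (M := ‖g‖) fun a b => ?_
    · exact (hsection b).stronglyMeasurable.integral_kernel.measurable
    · simpa [F] using norm_integral_le_of_norm_le_const (μ := R a)
        (ae_of_all _ fun x => g.norm_coe_le_norm (x, b))
  simpa only [integral_transportFst] using! continuousOn_integral_apply_of_fst_eq hF ν₀ hν₀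

theorem isCompact_setOf_exists_eq_compProd_comap {A A' : Type*} [MeasurableSpace A]
    [TopologicalSpace A] [PolishSpace A] [BorelSpace A] [MeasurableSpace A'] [TopologicalSpace A']
    [PolishSpace A'] [BorelSpace A'] (μ : Measure A) [IsProbabilityMeasure μ] {f : A → A'}
    (hf : Measurable f) :
    IsCompact {ν : ProbabilityMeasure (A × B) | ∃ κ : Kernel A' B, IsMarkovKernel κ ∧
      (ν : Measure (A × B)) = μ ⊗ₘ κ.comap f hf} := by
  let := TopologicalSpace.metrizableSpaceMetric B
  have : PolishSpace B := inferInstance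
  have : Nonempty A := μ.nonempty_of_neZero
  have : IsProbabilityMeasure (μ.map f) := Measure.isProbabilityMeasure_map hf.aemeasurable
  let R := condDistrib id f μ
  have himage : {ν : ProbabilityMeasure (A × B) | ∃ κ : Kernel A' B, IsMarkovKernel κ ∧
      (ν : Measure (A × B)) = μ ⊗ₘ κ.comap f hf} =
      transportFst R '' {ν | (ν : Measure (A' × B)).fst = μ.map f} := by
    refine Set.Subset.antisymm ?_ ?_
    · rintro ν ⟨κ, hκ, hν⟩
      refine ⟨⟨μ.map f ⊗ₘ κ, inferInstance⟩, Measure.fst_compProd _ _, Subtype.ext ?_⟩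
      exact (parallelComp_condDistrib_comp_compProd μ hf κ).trans hν.symm
    · rintro _ ⟨ν, hν, rfl⟩
      have : Nonempty B := (ν : Measure (A' × B)).nonempty_of_neZero.map Prod.snd
      refine ⟨(ν : Measure (A' × B)).condKernel, inferInstance, ?_⟩
      rw [← parallelComp_condDistrib_comp_compProd μ hf, ← show _ = μ.map f from hν,
        Measure.disintegrate]
      rfl
  rw [himage]
  exact (isCompact_setOf_fst_eq _).image_of_continuousOn (continuousOn_transportFst _ R)

end Pullback

section Causality

theorem Hist.take_append {Z : ℕ → Type*} {k m : ℕ} (h : k ≤ m) (p : Hist Z m × Z m) :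
    Hist.take (h.trans m.le_succ) (Hist.append p) = Hist.take h p.1 :=
  funext fun j => Fin.snoc_castSucc (α := fun j : Fin (m + 1) => Z j) p.2 p.1 (Fin.castLE h j)

theorem Hist.append_take_last {Z : ℕ → Type*} {k : ℕ} (z : Hist Z (k + 1)) :
    Hist.append (Hist.take k.le_succ z, z (Fin.last k)) = z :=
  Fin.snoc_init_self z

theorem Hist.continuous_take {Z : ℕ → Type*} [∀ i, TopologicalSpace (Z i)] {k m : ℕ} (h : k ≤ m) :
    Continuous (Hist.take (Z := Z) h) :=
  continuous_pi fun j => continuous_apply (Fin.castLE h j)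

theorem Hist.take_surjective {Z : ℕ → Type*} {k m : ℕ} (h : k ≤ m) [Nonempty (Hist Z m)] :
    Function.Surjective (Hist.take (Z := Z) h) := by
  intro z
  let z₀ : Hist Z m := Classical.arbitrary _
  refine ⟨fun j => if hj : (j : ℕ) < k then z ⟨j, hj⟩ else z₀ j, funext fun j => ?_⟩
  exact dif_pos j.isLt

theorem Hist.compactSpace_of_le {Z : ℕ → Type*} [∀ i, TopologicalSpace (Z i)] {k m : ℕ}
    (h : k ≤ m) [Nonempty (Hist Z m)] [CompactSpace (Hist Z m)] : CompactSpace (Hist Z k) :=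
  (Hist.take_surjective h).compactSpace (Hist.continuous_take h)

variable {X Y : ℕ → Type*} [∀ i, MeasurableSpace (X i)] [∀ i, MeasurableSpace (Y i)]

section CausalProd

variable {q : ∀ i, Kernel (Hist X (i + 1) × Hist Y i) (Y i)} {m : ℕ}

theorem isMarkovKernel_causalProd (hq : ∀ i < m, IsMarkovKernel (q i)) :
    IsMarkovKernel (causalProd q m) := by
  induction m with
  | zero => rw [causalProd]; infer_instance
  | succ m ih =>
    have := ih fun i hi => hq i (hi.trans m.lt_succ_self)
    have := hq m m.lt_succ_self
    exact Kernel.IsMarkovKernel.map _ Hist.measurable_append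

theorem causalProd_succ_apply (hq : ∀ i ≤ m, IsMarkovKernel (q i)) (x : Hist X (m + 1)) :
    causalProd q (m + 1) x =
      (causalProd q m (Hist.take m.le_succ x) ⊗ₘ (q m).sectR x).map Hist.append := by
  have := isMarkovKernel_causalProd fun i hi => hq i (Nat.le_of_lt hi)
  have := hq m le_rfl
  rw [causalProd, Kernel.map_apply _ Hist.measurable_append,
    Kernel.compProd_apply_eq_compProd_sectR, Kernel.comap_apply]

theorem map_take_causalProd {k : ℕ} (hkm : k ≤ m) (hq : ∀ i < m, IsMarkovKernel (q i))
    (x : Hist X m) :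
    (causalProd q m x).map (Hist.take hkm) = causalProd q k (Hist.take hkm x) := by
  induction m, hkm using Nat.le_induction with
  | base => exact Measure.map_id
  | succ m hkm ih =>
    have hq' (i : ℕ) (hi : i < m) : IsMarkovKernel (q i) := hq i (Nat.lt_succ_of_lt hi)
    have := isMarkovKernel_causalProd hq'
    have := hq m m.lt_succ_self
    have hcomp : (Hist.take (hkm.trans m.le_succ) : Hist Y (m + 1) → Hist Y k) ∘ Hist.append =
        Hist.take hkm ∘ Prod.fst := funext fun p => Hist.take_append hkm p
    rw [causalProd_succ_apply (fun i hi => hq i (Nat.lt_succ_of_le hi)),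
      Measure.map_map (Hist.measurable_take _) Hist.measurable_append, hcomp,
      ← Measure.map_map (Hist.measurable_take _) measurable_fst, ← Measure.fst,
      Measure.fst_compProd, ih hq']
    rfl

end CausalProd

theorem exists_map_append_compProd_sectR_eq {A : Type*} [MeasurableSpace A]
    [∀ i, StandardBorelSpace (Y i)] {k : ℕ} [Nonempty (Y k)]
    (η : Kernel A (Hist Y (k + 1))) [IsMarkovKernel η] :
    ∃ q : Kernel (A × Hist Y k) (Y k), IsMarkovKernel q ∧
      ∀ a, ((η a).map (Hist.take k.le_succ) ⊗ₘ q.sectR a).map Hist.append = η a := by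
  let split (y : Hist Y (k + 1)) : Hist Y k × Y k := (Hist.take k.le_succ y, y (Fin.last k))
  have hsplit : Measurable split :=
    (Hist.measurable_take _).prodMk (measurable_pi_apply (Fin.last k))
  have : IsMarkovKernel (η.map split) := Kernel.IsMarkovKernel.map _ hsplit
  refine ⟨(η.map split).condKernel, inferInstance, fun a => ?_⟩
  have hfst : (η a).map (Hist.take k.le_succ) = (η.map split).fst a := by
    rw [Kernel.fst_apply, Kernel.map_apply _ hsplit, Measure.map_map measurable_fst hsplit]
    rfl
  rw [hfst, ← Kernel.compProd_apply_eq_compProd_sectR, Kernel.disintegrate,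
    Kernel.map_apply _ hsplit, Measure.map_map Hist.measurable_append hsplit]
  exact (congrArg (η a).map (funext Hist.append_take_last)).trans Measure.map_id

variable {m : ℕ}

/-- A joint law `ν` with source law `μ` is causal if, for every `k`, the conditional law of the
first `k` outputs given the whole source sequence depends only on its first `k` symbols. -/
def IsCausal (μ : Measure (Hist X m)) (ν : Measure (Hist X m × Hist Y m)) : Prop :=
  ∀ k (hk : k ≤ m), ∃ η : Kernel (Hist X k) (Hist Y k), IsMarkovKernel η ∧
    ν.map (Prod.map id (Hist.take hk)) = μ ⊗ₘ η.comap (Hist.take hk) (Hist.measurable_take hk)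

theorem isCausal_compProd_causalProd (μ : Measure (Hist X m)) [SFinite μ]
    {q : ∀ i, Kernel (Hist X (i + 1) × Hist Y i) (Y i)} (hq : ∀ i < m, IsMarkovKernel (q i)) :
    IsCausal μ (μ ⊗ₘ causalProd q m) := by
  intro k hk
  have := isMarkovKernel_causalProd hq
  refine ⟨causalProd q k, isMarkovKernel_causalProd fun i hi => hq i (hi.trans_le hk), ?_⟩
  rw [← Measure.compProd_map (Hist.measurable_take hk)]
  congr 1
  ext1 x
  rw [Kernel.map_apply _ (Hist.measurable_take hk), map_take_causalProd hk hq, Kernel.comap_apply]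

theorem ae_map_take_eq_of_map_eq_compProd [∀ i, StandardBorelSpace (Y i)]
    {μ : Measure (Hist X m)} [IsFiniteMeasure μ] {ν : Measure (Hist X m × Hist Y m)} {k : ℕ}
    (hk : k < m) {κ : Kernel (Hist X m) (Hist Y k)} {κ' : Kernel (Hist X m) (Hist Y (k + 1))}
    [IsFiniteKernel κ] [IsFiniteKernel κ']
    (hκ : ν.map (Prod.map id (Hist.take hk.le)) = μ ⊗ₘ κ)
    (hκ' : ν.map (Prod.map id (Hist.take hk)) = μ ⊗ₘ κ') :
    ∀ᵐ x ∂μ, (κ' x).map (Hist.take k.le_succ) = κ x := by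
  have htake := Hist.measurable_take (Z := Y) k.le_succ
  have hmap : μ ⊗ₘ κ'.map (Hist.take k.le_succ) = μ ⊗ₘ κ := by
    rw [Measure.compProd_map htake, ← hκ', ← hκ, Measure.map_map (measurable_id.prodMap htake)
      (measurable_id.prodMap (Hist.measurable_take hk))]
    rfl
  filter_upwards [Kernel.ae_eq_of_compProd_eq hmap] with x hx
  rw [← hx, Kernel.map_apply _ htake]

theorem IsCausal.exists_eq_compProd_causalProd [∀ i, StandardBorelSpace (Y i)]
    {μ : Measure (Hist X m)} [IsFiniteMeasure μ] {ν : Measure (Hist X m × Hist Y m)} [NeZero ν]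
    (hν : IsCausal μ ν) :
    ∃ q : ∀ i, Kernel (Hist X (i + 1) × Hist Y i) (Y i),
      (∀ i < m, IsMarkovKernel (q i)) ∧ ν = μ ⊗ₘ causalProd q m := by
  choose η hη hνη using hν
  have hq (k : ℕ) : ∃ q : Kernel (Hist X (k + 1) × Hist Y k) (Y k), ∀ hk : k < m,
      IsMarkovKernel q ∧ ∀ x, ((η (k + 1) hk x).map (Hist.take k.le_succ) ⊗ₘ q.sectR x).map
        Hist.append = η (k + 1) hk x := by
    by_cases hk : k < m
    · have : Nonempty (Y k) := ν.nonempty_of_neZero.map fun p => p.2 ⟨k, hk⟩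
      obtain ⟨q, hq⟩ := exists_map_append_compProd_sectR_eq (η (k + 1) hk)
      exact ⟨q, fun _ => hq⟩
    · exact ⟨0, fun h => absurd h hk⟩
  choose q hq using hq
  have hqm (k : ℕ) (hk : k ≤ m) : ∀ i < k, IsMarkovKernel (q i) :=
    fun i hi => (hq i (hi.trans_le hk)).1
  have hae (k : ℕ) (hk : k ≤ m) :
      ∀ᵐ x ∂μ, causalProd q k (Hist.take hk x) = η k hk (Hist.take hk x) := by
    induction k with
    | zero =>
      have := isMarkovKernel_causalProd (hqm 0 hk)
      refine ae_of_all _ fun x => Measure.ext fun s _ => ?_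
      obtain rfl | hs := s.eq_empty_or_nonempty
      · simp
      · rw [Subsingleton.eq_univ_of_nonempty hs, measure_univ, measure_univ]
    | succ k ih =>
      filter_upwards [ih (Nat.le_of_succ_le hk),
        ae_map_take_eq_of_map_eq_compProd hk (hνη k _) (hνη (k + 1) hk)] with x hx hmap
      rw [causalProd_succ_apply fun i hi => hqm (k + 1) hk i (Nat.lt_succ_of_le hi),
        ← (hq k hk).2]
      exact congrArg (fun μ => (μ ⊗ₘ (q k).sectR _).map Hist.append) (hx.trans hmap.symm)
  have := isMarkovKernel_causalProd (hqm m le_rfl)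
  refine ⟨q, hqm m le_rfl, ?_⟩
  calc ν = ν.map (Prod.map id (Hist.take le_rfl)) := Measure.map_id.symm
    _ = μ ⊗ₘ (η m le_rfl).comap (Hist.take le_rfl) _ := hνη m le_rfl
    _ = μ ⊗ₘ causalProd q m := (Measure.compProd_congr (hae m le_rfl)).symm

theorem IsCausal.fst_eq {μ : Measure (Hist X m)} [SFinite μ] {ν : Measure (Hist X m × Hist Y m)}
    (hν : IsCausal μ ν) : ν.fst = μ := by
  obtain ⟨η, hη, hνη⟩ := hν m le_rfl
  rw [← Measure.fst_compProd μ (η.comap _ (Hist.measurable_take le_rfl)), ← hνη]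
  exact congrArg Measure.fst Measure.map_id.symm

theorem isCausal_iff_exists_mem_realizable [∀ i, StandardBorelSpace (Y i)] {n : ℕ}
    {μ : Measure (Hist X (n + 1))} [IsFiniteMeasure μ]
    {ν : Measure (Hist X (n + 1) × Hist Y (n + 1))} [NeZero ν] :
    IsCausal μ ν ↔ ∃ κ ∈ realizable μ, ν = μ ⊗ₘ κ := by
  constructor
  · intro hν
    obtain ⟨q, hq, hνq⟩ := hν.exists_eq_compProd_causalProd
    exact ⟨causalProd q (n + 1), ⟨isMarkovKernel_causalProd hq, q,
      fun i hi => hq i (Nat.lt_succ_of_le hi), ae_of_all _ fun _ => rfl⟩, hνq⟩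
  · rintro ⟨κ, ⟨hκ, q, hq, hκq⟩, rfl⟩
    have hq' (i : ℕ) (hi : i < n + 1) : IsMarkovKernel (q i) := hq i (Nat.le_of_lt_succ hi)
    have := isMarkovKernel_causalProd hq'
    rw [Measure.compProd_congr hκq]
    exact isCausal_compProd_causalProd μ hq'

theorem mutualInfo_eq_klDiv_prod_snd {A B : Type*} [MeasurableSpace A] [MeasurableSpace B]
    (μ : Measure A) [SFinite μ] (κ : Kernel A B) [IsSFiniteKernel κ] :
    mutualInfo μ κ = klDiv (μ ⊗ₘ κ) (μ.prod (μ ⊗ₘ κ).snd) := by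
  rw [mutualInfo, Measure.snd_compProd]

theorem measurable_distortion {ρ : ∀ i, Hist X (i + 1) → Hist Y (i + 1) → ℝ≥0∞} {n : ℕ}
    (hρ : ∀ i ≤ n, Measurable (Function.uncurry (ρ i))) :
    Measurable (Function.uncurry (distortion ρ n)) :=
  Finset.measurable_sum Finset.univ fun (i : Fin (n + 1)) _ =>
    (hρ i (Nat.le_of_lt_succ i.isLt)).comp
      ((Hist.measurable_take i.isLt).prodMap (Hist.measurable_take i.isLt))

theorem isCompact_setOf_isCausal
    [∀ i, TopologicalSpace (X i)] [∀ i, PolishSpace (X i)] [∀ i, BorelSpace (X i)]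
    [∀ i, TopologicalSpace (Y i)] [∀ i, PolishSpace (Y i)] [∀ i, BorelSpace (Y i)]
    [CompactSpace (Hist Y m)] (μ : Measure (Hist X m)) [IsProbabilityMeasure μ] :
    IsCompact {ν : ProbabilityMeasure (Hist X m × Hist Y m) |
      IsCausal μ (ν : Measure (Hist X m × Hist Y m))} := by
  obtain hempty | ⟨ν₀, -⟩ := Set.eq_empty_or_nonempty {ν : ProbabilityMeasure
      (Hist X m × Hist Y m) | IsCausal μ (ν : Measure (Hist X m × Hist Y m))}
  · exact hempty ▸ isCompact_empty
  have : Nonempty (Hist Y m) := (ν₀ : Measure (Hist X m × Hist Y m)).nonempty_of_neZero.map Prod.snd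
  have hclosed : IsClosed {ν : ProbabilityMeasure (Hist X m × Hist Y m) |
      IsCausal μ (ν : Measure (Hist X m × Hist Y m))} := by
    simp only [IsCausal, Set.ofPred_forall]
    refine isClosed_iInter fun k => isClosed_iInter fun hk => ?_
    have := Hist.compactSpace_of_le (Z := Y) hk
    exact (isCompact_setOf_exists_eq_compProd_comap μ (Hist.measurable_take hk)).isClosed.preimage
      (ProbabilityMeasure.continuous_map (continuous_id.prodMap (Hist.continuous_take hk)))
  exact (isCompact_setOf_fst_eq μ).of_isClosed_subset hclosed fun ν hν => IsCausal.fst_eq hν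

theorem isCompact_setOf_exists_mem_fidelitySet
    [∀ i, TopologicalSpace (X i)] [∀ i, PolishSpace (X i)] [∀ i, BorelSpace (X i)]
    [∀ i, TopologicalSpace (Y i)] [∀ i, PolishSpace (Y i)] [∀ i, BorelSpace (Y i)]
    {n : ℕ} [CompactSpace (Hist Y (n + 1))] (μ : Measure (Hist X (n + 1))) [IsProbabilityMeasure μ]
    {ρ : ∀ i, Hist X (i + 1) → Hist Y (i + 1) → ℝ≥0∞}
    (hρ : ∀ i ≤ n, Measurable (Function.uncurry (ρ i)))
    (hd : ∀ x, Continuous (distortion ρ n x)) (D : ℝ≥0) :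
    IsCompact {ν : ProbabilityMeasure (Hist X (n + 1) × Hist Y (n + 1)) |
      ∃ κ ∈ fidelitySet μ ρ D, (ν : Measure (Hist X (n + 1) × Hist Y (n + 1))) = μ ⊗ₘ κ} := by
  let Ω := Hist X (n + 1) × Hist Y (n + 1)
  let cost (ν : ProbabilityMeasure Ω) : ℝ≥0∞ := ∫⁻ p, distortion ρ n p.1 p.2 ∂(ν : Measure Ω)
  have hcost : LowerSemicontinuousOn cost {ν | IsCausal μ (ν : Measure Ω)} :=
    (lowerSemicontinuousOn_lintegral_of_fst_eq μ (measurable_distortion hρ) hd).mono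
      fun ν hν => IsCausal.fst_eq hν
  convert hcost.isCompact_inter_preimage_Iic (isCompact_setOf_isCausal μ) D using 1
  ext ν
  change _ ↔ IsCausal μ (ν : Measure Ω) ∧ cost ν ≤ D
  rw [isCausal_iff_exists_mem_realizable]
  constructor
  · rintro ⟨κ, ⟨hκD, hκ⟩, hνκ⟩
    refine ⟨⟨κ, hκ, hνκ⟩, ?_⟩
    simpa only [cost, hνκ] using! hκD
  · rintro ⟨⟨κ, hκ, hνκ⟩, hνD⟩
    refine ⟨κ, ⟨?_, hκ⟩, hνκ⟩
    simpa only [cost, hνκ] using! hνD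

end Causality

end CausalRD

theorem theorem1 {X Y : ℕ → Type*}
    [∀ i, TopologicalSpace (X i)] [∀ i, PolishSpace (X i)]
    [∀ i, MeasurableSpace (X i)] [∀ i, BorelSpace (X i)]
    [∀ i, TopologicalSpace (Y i)] [∀ i, PolishSpace (Y i)]
    [∀ i, MeasurableSpace (Y i)] [∀ i, BorelSpace (Y i)]
    (n : ℕ) [CompactSpace (CausalRD.Hist Y (n + 1))]
    (μ : Measure (CausalRD.Hist X (n + 1))) [IsProbabilityMeasure μ]
    (ρ : ∀ i, CausalRD.Hist X (i + 1) → CausalRD.Hist Y (i + 1) → ℝ≥0∞)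
    (hρ : ∀ i ≤ n, Measurable (Function.uncurry (ρ i)))
    (hd : ∀ x : CausalRD.Hist X (n + 1),
      Continuous fun y : CausalRD.Hist Y (n + 1) => CausalRD.distortion ρ n x y)
    (D : ℝ≥0) (hD : (CausalRD.fidelitySet μ ρ D).Nonempty) :
    ∃ κ ∈ CausalRD.fidelitySet μ ρ D,
      CausalRD.mutualInfo μ κ = CausalRD.causalRDF μ ρ D := by
  open CausalRD in
  let Ω := Hist X (n + 1) × Hist Y (n + 1)
  let info (ν : ProbabilityMeasure Ω) : ℝ≥0∞ := klDiv (ν : Measure Ω) (μ.prod (ν : Measure Ω).snd)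
  let K : Set (ProbabilityMeasure Ω) := {ν | ∃ κ ∈ fidelitySet μ ρ D, (ν : Measure Ω) = μ ⊗ₘ κ}
  have hinfo : LowerSemicontinuous info := lowerSemicontinuous_klDiv_prod_snd ⟨μ, inferInstance⟩
  have hK : IsCompact K := isCompact_setOf_exists_mem_fidelitySet μ hρ hd D
  have hjoint (κ) (hκ : κ ∈ fidelitySet μ ρ D) : ∃ ν ∈ K, (ν : Measure Ω) = μ ⊗ₘ κ := by
    have := hκ.2.1
    exact ⟨⟨μ ⊗ₘ κ, inferInstance⟩, ⟨κ, hκ, rfl⟩, rfl⟩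
  obtain ⟨ν₀, hν₀, -⟩ := hjoint _ hD.some_mem
  obtain ⟨ν, ⟨κ, hκ, hνκ⟩, hmin⟩ := (hinfo.lowerSemicontinuousOn K).exists_isMinOn ⟨ν₀, hν₀⟩ hK
  refine ⟨κ, hκ, le_antisymm (le_iInf₂ fun κ' hκ' => ?_) (iInf₂_le κ hκ)⟩
  obtain ⟨ν', hν', hνκ'⟩ := hjoint κ' hκ'
  have hκ_markov : IsMarkovKernel κ := hκ.2.1
  have hκ_markov' : IsMarkovKernel κ' := hκ'.2.1
  rw [mutualInfo_eq_klDiv_prod_snd, mutualInfo_eq_klDiv_prod_snd, ← hνκ, ← hνκ']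
  exact hmin hν'
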